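/- A \emph{rooted forest} (possibly infinite, possibly empty) is a disjoint union of rooted trees with arcs directed towards the roots; forests are considered up to isomorphism. With the disjoint union as sum and the levelwise product (the nodes of $\mathbf F\times\mathbf G$ are the pairs $(v,u)$ of nodes $v$ of $\mathbf F$ and $u$ of $\mathbf G$ at the same distance from their roots, with an arc $(v,u)\to(v',u')$ iff there are arcs $v\to v'$ and $u\to u'$) they form a commutative semiring, whose zero is the empty forest and whose unit is the infinite path. The depth $\operatorname{depth}(\mathbf F)$ of a forest is the supremum of the distances of its nodes from their roots ($0$ for the empty forest). A finite deterministic dynamical system (FDDS) is a function $f:A\to A$ on a finite set $A$. Its \emph{unroll} is the forest whose nodes are the pairs $(a,k)\in A\times\mathbb N$ such that $f^k(a)$ lies on a limit cycle of $f$, with the arcs $(a,k+1)\to(f(a),k)$. The unrolls of FDDSs, up to isomorphism, form a subsemiring of the semiring of forests. (1) Every non-constant polynomial over the semiring of unrolls is injective: if $P=\sum_{i=0}^m A_iX^i$ has unrolls as coefficients, with $A_i\neq 0$ for some $i>0$, and if $X,Y$ are unrolls with $P(X)=P(Y)$, then $X=Y$. (2) Let $P=\sum_{i=0}^m\mathbf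 A_i\mathbf X^i$ be a polynomial whose coefficients are finite forests, with $\mathbf A_i\ne\mathbf 0$ for some $i>0$. Let $d_{\max}=\max_{1\le i\le m}\operatorname{depth}(\mathbf A_i)$ and assume $\operatorname{depth}(\mathbf A_0)\le d_{\max}$. Then $P$ is injective on the semiring of finite forests of depth at most $d_{\max}$. -/

import Mathlib

/-- A rooted forest (possibly infinite, possibly empty), presented by depth: `level n` is the set
of nodes at distance `n` from the root of their tree, and the arcs, directed towards the roots, go
from each node of depth `n + 1` to its parent, of depth `n`. The roots are the nodes of level `0`;
the trees of the forest correspond to its roots. -/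
structure LevelForest : Type 1 where
  level : ℕ → Type
  parent : ∀ n, level (n + 1) → level n

namespace LevelForest

/-- Isomorphisms of rooted forests. -/
structure Iso (F G : LevelForest) : Type where
  equiv : ∀ n, F.level n ≃ G.level n
  comm : ∀ n (v : F.level (n + 1)), equiv n (F.parent n v) = G.parent n (equiv (n + 1) v)

def Iso.refl (F : LevelForest) : Iso F F := ⟨fun _ => Equiv.refl _, fun _ _ => rfl⟩

def Iso.symm {F G : LevelForest} (e : Iso F G) : Iso G F :=
  ⟨fun n => (e.equiv n).symm, fun n v => by
    rw [Equiv.symm_apply_eq, e.comm, Equiv.apply_symm_apply]⟩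

def Iso.trans {F G H : LevelForest} (e : Iso F G) (e' : Iso G H) : Iso F H :=
  ⟨fun n => (e.equiv n).trans (e'.equiv n), fun n v => by simp [e.comm, e'.comm]⟩

instance setoid : Setoid LevelForest where
  r F G := Nonempty (Iso F G)
  iseqv := ⟨fun F => ⟨Iso.refl F⟩, fun ⟨e⟩ => ⟨e.symm⟩, fun ⟨e⟩ ⟨e'⟩ => ⟨e.trans e'⟩⟩

/-- Disjoint union of forests. -/
def sum (F G : LevelForest) : LevelForest where
  level n := F.level n ⊕ G.level n
  parent n := Sum.map (F.parent n) (G.parent n)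

/-- Level by level Cartesian product of forests: the nodes are the pairs of nodes of equal depth,
and there is an arc between two pairs when there is one in both coordinates. -/
def prod (F G : LevelForest) : LevelForest where
  level n := F.level n × G.level n
  parent n := Prod.map (F.parent n) (G.parent n)

/-- The empty forest. -/
def empty : LevelForest := ⟨fun _ => Empty, fun _ => id⟩

/-- The infinite path. -/
def path : LevelForest := ⟨fun _ => Unit, fun _ => id⟩

def Iso.sum {F F' G G' : LevelForest} (e : Iso F F') (e' : Iso G G') :
    Iso (F.sum G) (F'.sum G') :=
  ⟨fun n => Equiv.sumCongr (e.equiv n) (e'.equiv n), by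
    rintro n (v | v)
    · exact congrArg Sum.inl (e.comm n v)
    · exact congrArg Sum.inr (e'.comm n v)⟩

def Iso.prod {F F' G G' : LevelForest} (e : Iso F F') (e' : Iso G G') :
    Iso (F.prod G) (F'.prod G') :=
  ⟨fun n => Equiv.prodCongr (e.equiv n) (e'.equiv n), fun n v =>
    Prod.ext (e.comm n v.1) (e'.comm n v.2)⟩

/-- The depth of a forest: the supremum of the depths of its nodes (`⊤` when there are nodes of
arbitrarily large depth, and `0` for the empty forest). -/
noncomputable def depth (F : LevelForest) : ℕ∞ := ⨆ (n : ℕ) (_ : Nonempty (F.level n)), (n : ℕ∞)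

/-- A forest is finite when it has finitely many nodes. -/
def IsFinite (F : LevelForest) : Prop := Finite (Σ n, F.level n)

theorem Iso.depth_eq {F G : LevelForest} (e : Iso F G) : F.depth = G.depth := by
  simp only [depth, (e.equiv _).nonempty_congr]

theorem Iso.isFinite_iff {F G : LevelForest} (e : Iso F G) : F.IsFinite ↔ G.IsFinite :=
  (Equiv.sigmaCongrRight e.equiv).finite_iff

end LevelForest

/-- Rooted forests up to isomorphism. -/
def Forest : Type 1 := Quotient LevelForest.setoid

namespace Forest

open LevelForest

/-- The isomorphism class of a forest. -/
def mk (F : LevelForest) : Forest := Quotient.mk _ F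

theorem mk_eq {F G : LevelForest} (e : LevelForest.Iso F G) : mk F = mk G :=
  Quotient.sound ⟨e⟩

instance : Zero Forest := ⟨mk LevelForest.empty⟩

instance : One Forest := ⟨mk LevelForest.path⟩

instance : Add Forest :=
  ⟨Quotient.map₂ LevelForest.sum fun _ _ ⟨e⟩ _ _ ⟨e'⟩ => ⟨e.sum e'⟩⟩

instance : Mul Forest :=
  ⟨Quotient.map₂ LevelForest.prod fun _ _ ⟨e⟩ _ _ ⟨e'⟩ => ⟨e.prod e'⟩⟩

theorem ind {p : Forest → Prop} (h : ∀ F, p (mk F)) (F : Forest) : p F := Quotient.ind h F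

theorem mk_add (F G : LevelForest) : mk F + mk G = mk (F.sum G) := rfl

theorem mk_mul (F G : LevelForest) : mk F * mk G = mk (F.prod G) := rfl

theorem zero_def : (0 : Forest) = mk LevelForest.empty := rfl

theorem one_def : (1 : Forest) = mk LevelForest.path := rfl

protected theorem add_comm' (F G : Forest) : F + G = G + F := by
  induction F using ind with | _ F
  induction G using ind with | _ G
  exact mk_eq ⟨fun _ => Equiv.sumComm _ _, by rintro n (v | v) <;> rfl⟩

protected theorem mul_comm' (F G : Forest) : F * G = G * F := by
  induction F using ind with | _ F
  induction G using ind with | _ G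
  exact mk_eq ⟨fun _ => Equiv.prodComm _ _, fun _ _ => rfl⟩

protected theorem zero_add' (F : Forest) : 0 + F = F := by
  induction F using ind with | _ F
  exact mk_eq ⟨fun _ => Equiv.emptySum Empty _, by rintro n (v | v) <;> [cases v; rfl]⟩

protected theorem zero_mul' (F : Forest) : 0 * F = 0 := by
  induction F using ind with | _ F
  exact mk_eq ⟨fun _ => Equiv.emptyProd _, fun n v => v.1.elim⟩

protected theorem one_mul' (F : Forest) : 1 * F = F := by
  induction F using ind with | _ F
  exact mk_eq ⟨fun _ => Equiv.punitProd _, fun n v => rfl⟩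

protected theorem right_distrib' (F G H : Forest) : (F + G) * H = F * H + G * H := by
  induction F using ind with | _ F
  induction G using ind with | _ G
  induction H using ind with | _ H
  exact mk_eq ⟨fun _ => Equiv.sumProdDistrib _ _ _, by rintro n ⟨v | v, w⟩ <;> rfl⟩

/-- Forests up to isomorphism, with disjoint union and level by level product, are a commutative
semiring, where `0` is the empty forest and `1` is the infinite path. -/
instance : CommSemiring Forest where
  add_assoc F G H := by
    induction F using ind with | _ F
    induction G using ind with | _ G
    induction H using ind with | _ H
    exact mk_eq ⟨fun _ => Equiv.sumAssoc _ _ _, by rintro n ((v | v) | v) <;> rfl⟩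
  zero_add := Forest.zero_add'
  add_zero F := by rw [Forest.add_comm', Forest.zero_add']
  add_comm := Forest.add_comm'
  nsmul := nsmulRec
  mul_assoc F G H := by
    induction F using ind with | _ F
    induction G using ind with | _ G
    induction H using ind with | _ H
    exact mk_eq ⟨fun _ => Equiv.prodAssoc _ _ _, fun _ _ => rfl⟩
  one_mul := Forest.one_mul'
  mul_one F := by rw [Forest.mul_comm', Forest.one_mul']
  mul_comm := Forest.mul_comm'
  zero_mul := Forest.zero_mul'
  mul_zero F := by rw [Forest.mul_comm', Forest.zero_mul']
  right_distrib := Forest.right_distrib'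
  left_distrib F G H := by
    rw [Forest.mul_comm', Forest.right_distrib', Forest.mul_comm' G, Forest.mul_comm' H]

/-- The depth of a forest (`⊤` when there are nodes of arbitrarily large depth, and `0` for the
empty forest). -/
noncomputable def depth : Forest → ℕ∞ :=
  Quotient.lift LevelForest.depth fun _ _ ⟨e⟩ => e.depth_eq

/-- A forest is finite when it has finitely many nodes. -/
def IsFinite : Forest → Prop :=
  Quotient.lift LevelForest.IsFinite fun _ _ ⟨e⟩ => propext e.isFinite_iff

theorem depth_mk_le {F : LevelForest} {d : ℕ∞} :
    (mk F).depth ≤ d ↔ ∀ n : ℕ, Nonempty (F.level n) → (n : ℕ∞) ≤ d :=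
  iSup₂_le_iff

theorem isFinite_mk {F : LevelForest} : (mk F).IsFinite ↔ Finite (Σ n, F.level n) := Iff.rfl

/-- The semiring of finite forests of depth at most `d`. (Its unit, the path with nodes of depth
`0, …, d`, differs from the infinite path when `d` is finite; its sum, product and zero are those
of all forests.) -/
def finiteForests (d : ℕ∞) : NonUnitalSubsemiring Forest where
  carrier := {F | F.IsFinite ∧ F.depth ≤ d}
  zero_mem' := by
    refine ⟨?_, depth_mk_le.2 fun n ⟨v⟩ => v.elim⟩
    have : IsEmpty (Σ n, LevelForest.empty.level n) := ⟨fun v => v.2.elim⟩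
    exact isFinite_mk.2 inferInstance
  add_mem' {F G} := by
    induction F using ind with | _ F
    induction G using ind with | _ G
    rintro ⟨hF, hF'⟩ ⟨hG, hG'⟩
    rw [isFinite_mk] at hF hG
    rw [depth_mk_le] at hF' hG'
    constructor
    · exact isFinite_mk.2 (Finite.of_equiv _ (Equiv.sigmaSumDistrib F.level G.level).symm)
    · refine depth_mk_le.2 ?_
      rintro n ⟨v | v⟩
      exacts [hF' n ⟨v⟩, hG' n ⟨v⟩]
  mul_mem' {F G} := by
    induction F using ind with | _ F
    induction G using ind with | _ G
    rintro ⟨hF, hF'⟩ ⟨hG, -⟩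
    rw [isFinite_mk] at hF hG
    rw [depth_mk_le] at hF'
    constructor
    · refine isFinite_mk.2 (Finite.of_injective
        (β := (Σ n, F.level n) × (Σ n, G.level n))
        (fun v => (⟨v.1, v.2.1⟩, ⟨v.1, v.2.2⟩)) ?_)
      rintro ⟨n, v, w⟩ ⟨n', v', w'⟩ h
      simp only [Prod.mk.injEq, Sigma.mk.injEq] at h
      obtain ⟨⟨rfl, h⟩, -, h'⟩ := h
      rw [eq_of_heq h, eq_of_heq h']
    · exact depth_mk_le.2 fun n ⟨v⟩ => hF' n ⟨v.1⟩

end Forest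

/-- A finite deterministic dynamical system. -/
structure FDDS : Type 1 where
  State : Type
  finite : Finite State
  next : State → State

namespace FDDS

attribute [instance] FDDS.finite

/-- Alternative execution (disjoint union). -/
def sum (A B : FDDS) : FDDS := ⟨A.State ⊕ B.State, inferInstance, Sum.map A.next B.next⟩

/-- Synchronous execution (direct product). -/
def prod (A B : FDDS) : FDDS := ⟨A.State × B.State, inferInstance, Prod.map A.next B.next⟩

/-- The empty system. -/
def empty : FDDS := ⟨Empty, inferInstance, id⟩

/-- The fixed point. -/
def point : FDDS := ⟨Unit, inferInstance, id⟩

/-- A state is on a limit cycle when it is periodic. -/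
def OnCycle (A : FDDS) (u : A.State) : Prop := u ∈ Function.periodicPts A.next

/-- The unroll of `A`: its nodes of depth `k` are the pairs `(a, k)` such that `A.next^[k] a` is on
a limit cycle, with the arcs `(a, k + 1) → (A.next a, k)`. When `A` is not connected, this is the
sum of the unrolls of its connected components (see `FDDS.unroll_sum`). -/
def unroll (A : FDDS) : LevelForest where
  level k := {a : A.State // A.OnCycle (A.next^[k] a)}
  parent _ v := ⟨A.next v.1, v.2⟩

theorem onCycle_inl (A B : FDDS) (a : A.State) (k : ℕ) :
    (A.sum B).OnCycle ((A.sum B).next^[k] (Sum.inl a)) ↔ A.OnCycle (A.next^[k] a) := by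
  have h : ∀ (n : ℕ) (a : A.State), (A.sum B).next^[n] (Sum.inl a) = Sum.inl (A.next^[n] a) := by
    intro n
    induction n with
    | zero => exact fun _ => rfl
    | succ n ih => exact fun a => ih (A.next a)
  rw [h]
  refine exists_congr fun n => and_congr_right fun _ => ?_
  exact (Eq.congr_left (h n _)).trans Sum.inl_injective.eq_iff

theorem onCycle_inr (A B : FDDS) (b : B.State) (k : ℕ) :
    (A.sum B).OnCycle ((A.sum B).next^[k] (Sum.inr b)) ↔ B.OnCycle (B.next^[k] b) := by
  have h : ∀ (n : ℕ) (b : B.State), (A.sum B).next^[n] (Sum.inr b) = Sum.inr (B.next^[n] b) := by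
    intro n
    induction n with
    | zero => exact fun _ => rfl
    | succ n ih => exact fun b => ih (B.next b)
  rw [h]
  refine exists_congr fun n => and_congr_right fun _ => ?_
  exact (Eq.congr_left (h n _)).trans Sum.inr_injective.eq_iff

theorem onCycle_prod (A B : FDDS) (a : A.State) (b : B.State) (k : ℕ) :
    (A.prod B).OnCycle ((A.prod B).next^[k] (a, b)) ↔
      A.OnCycle (A.next^[k] a) ∧ B.OnCycle (B.next^[k] b) := by
  have h : (A.prod B).next^[k] (a, b) = (A.next^[k] a, B.next^[k] b) := by
    change (Prod.map A.next B.next)^[k] (a, b) = _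
    rw [Prod.map_iterate]
    rfl
  rw [h]
  simp only [OnCycle]
  change (_ ∈ Function.periodicPts (Prod.map A.next B.next)) ↔ _
  simp only [Function.mem_periodicPts, Function.isPeriodicPt_prodMap]
  constructor
  · rintro ⟨n, hn, h1, h2⟩
    exact ⟨⟨n, hn, h1⟩, ⟨n, hn, h2⟩⟩
  · rintro ⟨⟨n, hn, h1⟩, ⟨m, hm, h2⟩⟩
    exact ⟨n * m, Nat.mul_pos hn hm, h1.mul_const m, h2.const_mul n⟩

theorem unroll_sum (A B : FDDS) :
    Forest.mk A.unroll + Forest.mk B.unroll = Forest.mk (A.sum B).unroll :=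
  Forest.mk_eq
    { equiv := fun k =>
        { toFun := Sum.elim (fun v => ⟨Sum.inl v.1, (onCycle_inl A B _ k).2 v.2⟩)
            (fun v => ⟨Sum.inr v.1, (onCycle_inr A B _ k).2 v.2⟩)
          invFun := fun
            | ⟨Sum.inl a, h⟩ => Sum.inl ⟨a, (onCycle_inl A B _ k).1 h⟩
            | ⟨Sum.inr b, h⟩ => Sum.inr ⟨b, (onCycle_inr A B _ k).1 h⟩
          left_inv := by rintro (v | v) <;> rfl
          right_inv := by rintro ⟨v | v, h⟩ <;> rfl }
      comm := by rintro n (v | v) <;> rfl }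

theorem unroll_prod (A B : FDDS) :
    Forest.mk A.unroll * Forest.mk B.unroll = Forest.mk (A.prod B).unroll :=
  Forest.mk_eq
    { equiv := fun k =>
        { toFun := fun v => ⟨(v.1.1, v.2.1), (onCycle_prod A B _ _ k).2 ⟨v.1.2, v.2.2⟩⟩
          invFun := fun v => (⟨v.1.1, ((onCycle_prod A B _ _ k).1 v.2).1⟩,
            ⟨v.1.2, ((onCycle_prod A B _ _ k).1 v.2).2⟩)
          left_inv := fun _ => rfl
          right_inv := fun _ => rfl }
      comm := fun _ _ => rfl }

theorem unroll_empty : (0 : Forest) = Forest.mk empty.unroll :=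
  Forest.mk_eq ⟨fun _ => ⟨Empty.elim, fun v => v.1.elim, fun v => v.elim, fun v => v.1.elim⟩,
    fun _ v => v.elim⟩

theorem unroll_point : (1 : Forest) = Forest.mk point.unroll :=
  Forest.mk_eq ⟨fun _ => ⟨fun _ => ⟨(), 1, one_pos, rfl⟩, fun _ => (), fun _ => rfl, fun _ => rfl⟩,
    fun _ _ => rfl⟩

end FDDS

/-- The semiring of unrolls, up to isomorphism, of finite deterministic dynamical systems. -/
def unrolls : Subsemiring Forest where
  carrier := {F | ∃ A : FDDS, F = Forest.mk A.unroll}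
  zero_mem' := ⟨_, FDDS.unroll_empty⟩
  one_mem' := ⟨_, FDDS.unroll_point⟩
  add_mem' := by
    rintro _ _ ⟨A, rfl⟩ ⟨B, rfl⟩
    exact ⟨_, FDDS.unroll_sum A B⟩
  mul_mem' := by
    rintro _ _ ⟨A, rfl⟩ ⟨B, rfl⟩
    exact ⟨_, FDDS.unroll_prod A B⟩

open scoped ENNReal

/-! For a finite tree `t`, let `homCount t F` be the number of root-preserving homomorphisms from
`t` to `F`. A homomorphism into a levelwise product is a pair of homomorphisms, and a tree lands in
one summand of a disjoint union, so `homCount t` is a semiring homomorphism to `ℝ≥0∞`; infinite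
values are allowed so that it is defined on every forest. It turns `P(X) = P(Y)` into an equality of
values of a numerical polynomial with nonnegative coefficients. Where these are finite and some
non-constant one is nonzero, that polynomial is strictly increasing on finite arguments, so `X` and
`Y` have equal counts.

Two facts complete the argument. Counts determine locally finite forests
(`nonempty_iso_of_homCount_eq`): at a fixed node they form a character of the monoid of trees glued
at the root, and independence of characters matches nodes level by level. Moreover `t` maps to `F`
iff `F` has a node at depth `t.height` (`homCount_ne_zero_iff`). A nonzero unroll has nodes at all
depths, so no count of it vanishes; for finite forests, trees of height at most `dmax` are seen by a
non-constant coefficient, and taller ones count zero in both arguments. -/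

/-- Finite rooted plane trees, built from the one-node tree by grafting a tree `s` as the first
child of the root of a tree `t`. -/
inductive PlaneTree : Type
  | point : PlaneTree
  | graft (s t : PlaneTree) : PlaneTree

namespace PlaneTree

/-- The tree obtained by identifying the roots of two trees. -/
def merge : PlaneTree → PlaneTree → PlaneTree
  | point, u => u
  | graft s t, u => graft s (merge t u)

/-- Ordering the children does not affect counts, and makes gluing at the root strictly associative
without passing to a quotient. Commutativity is not needed to speak of characters. -/
instance : Monoid PlaneTree where
  one := point
  mul := merge
  one_mul _ := rfl
  mul_one t := by
    change merge t point = t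
    induction t with
    | point => rfl
    | graft s t _ ih => exact congrArg (graft s) ih
  mul_assoc t u w := by
    change merge (merge t u) w = merge t (merge u w)
    induction t with
    | point => rfl
    | graft s t _ ih => exact congrArg (graft s) ih

/-- The largest distance of a node from the root. -/
def height : PlaneTree → ℕ
  | point => 0
  | graft s t => max (height s + 1) (height t)

end PlaneTree

/-! ### Characters and numerical polynomials -/

/-- Two finite families of characters with the same sum agree up to reindexing. -/
theorem exists_equiv_of_sum_monoidHom_eq {M α β L : Type*} [Monoid M] [Fintype α] [Fintype β]
    [CommRing L] [IsDomain L] [CharZero L] (f : α → M →* L) (g : β → M →* L)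
    (h : ∀ m, ∑ a, f a m = ∑ b, g b m) : ∃ e : α ≃ β, ∀ a, g (e a) = f a := by
  classical
  have hli := linearIndependent_monoidHom M L
  -- By Dedekind's independence of characters, equal sums have equal formal sums.
  have key : ∑ a, Finsupp.single (f a) (1 : L) = ∑ b, Finsupp.single (g b) (1 : L) := by
    apply hli
    simp only [map_sum, Finsupp.linearCombination_single, one_smul]
    ext m
    simpa using h m
  -- The coefficient of `χ` is its multiplicity cast to `L`; characteristic zero recovers the
  -- natural number.
  have hcard (χ : M →* L) : Fintype.card {a // f a = χ} = Fintype.card {b // g b = χ} := by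
    have := DFunLike.congr_fun key χ
    simp only [Finsupp.finsetSum_apply, Finsupp.single_apply, Finset.sum_boole,
      Nat.cast_inj] at this
    simpa only [Fintype.card_subtype] using this
  let e (χ : M →* L) : {a // f a = χ} ≃ {b // g b = χ} := Fintype.equivOfCardEq (hcard χ)
  refine ⟨(Equiv.sigmaFiberEquiv f).symm.trans
    ((Equiv.sigmaCongrRight e).trans (Equiv.sigmaFiberEquiv g)), fun a => ?_⟩
  exact (e (f a) ⟨a, rfl⟩).2

/-- A polynomial with finite nonnegative coefficients that is not constant takes distinct values at
distinct finite arguments. -/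
theorem ENNReal.eq_of_sum_mul_pow_eq {m : ℕ} {a : ℕ → ℝ≥0∞} (ha : ∀ i ≤ m, a i ≠ ⊤)
    (hpos : ∃ i, 1 ≤ i ∧ i ≤ m ∧ a i ≠ 0) {x y : ℝ≥0∞} (hx : x ≠ ⊤) (hy : y ≠ ⊤)
    (h : ∑ i ∈ Finset.range (m + 1), a i * x ^ i = ∑ i ∈ Finset.range (m + 1), a i * y ^ i) :
    x = y := by
  wlog hxy : x < y generalizing x y
  · rcases eq_or_lt_of_le (not_lt.1 hxy) with h' | h'
    · exact h'.symm
    · exact (this hy hx h.symm h').symm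
  obtain ⟨j, hj, hjm, hj0⟩ := hpos
  refine absurd h (ne_of_lt ?_)
  have hjr : j ∈ Finset.range (m + 1) := Finset.mem_range.2 (by lia)
  rw [← Finset.add_sum_erase _ _ hjr, ← Finset.add_sum_erase _ _ hjr]
  -- The `j`-th term is strictly larger at `y`; strictness survives adding the other terms because
  -- their sum at `x` is finite.
  refine ENNReal.add_lt_add_of_lt_of_le ?_ ?_ ?_
  · refine ENNReal.sum_ne_top.2 fun i hi => ENNReal.mul_ne_top (ha i ?_) (ENNReal.pow_ne_top hx)
    have := Finset.mem_range.1 (Finset.mem_of_mem_erase hi)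
    lia
  · exact ENNReal.mul_lt_mul_right hj0 (ha j hjm) (ENNReal.pow_lt_pow_left (by lia) hxy)
  · gcongr

/-! ### Homomorphism counts under sum and product -/

namespace LevelForest

/-- The children of a node. -/
abbrev Child (F : LevelForest) {n : ℕ} (v : F.level n) : Type :=
  {c : F.level (n + 1) // F.parent n c = v}

/-- The number of homomorphisms from a tree to a forest sending the root to a given node. -/
noncomputable def rootedHomCount (F : LevelForest) : PlaneTree → ∀ {n : ℕ}, F.level n → ℝ≥0∞
  | .point, _, _ => 1
  | .graft s t, _, v => (∑' c : F.Child v, rootedHomCount F s c.1) * rootedHomCount F t v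

/-- The number of homomorphisms from a tree to a forest sending the root to a root. -/
noncomputable def homCount (F : LevelForest) (t : PlaneTree) : ℝ≥0∞ :=
  ∑' r : F.level 0, F.rootedHomCount t r

/-- Once the image of the common root is fixed, the two glued trees are mapped independently. -/
theorem rootedHomCount_mul (F : LevelForest) (t u : PlaneTree) {n : ℕ} (v : F.level n) :
    F.rootedHomCount (t * u) v = F.rootedHomCount t v * F.rootedHomCount u v := by
  induction t with
  | point => exact (one_mul _).symm
  | graft s t _ ih =>
    change _ * F.rootedHomCount (t * u) v = _ * _ * _
    rw [ih, mul_assoc]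

theorem Iso.rootedHomCount_eq {F G : LevelForest} (e : Iso F G) (t : PlaneTree) {n : ℕ}
    (v : F.level n) : F.rootedHomCount t v = G.rootedHomCount t (e.equiv n v) := by
  induction t generalizing n with
  | point => rfl
  | graft s t ihs iht =>
    simp only [rootedHomCount, iht, ihs]
    congr 1
    exact ((e.equiv (n + 1)).subtypeEquiv (p := fun c => F.parent n c = v)
      (q := fun c => G.parent n c = e.equiv n v) fun c => by
        rw [← e.comm, EmbeddingLike.apply_eq_iff_eq]).tsum_eq
      (fun c : G.Child (e.equiv n v) => G.rootedHomCount s c.1)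

theorem Iso.homCount_eq {F G : LevelForest} (e : Iso F G) (t : PlaneTree) :
    F.homCount t = G.homCount t := by
  simp only [homCount, e.rootedHomCount_eq t]
  exact (e.equiv 0).tsum_eq (G.rootedHomCount t)

theorem rootedHomCount_sum_inl (F G : LevelForest) (t : PlaneTree) {n : ℕ} (v : F.level n) :
    (F.sum G).rootedHomCount t (Sum.inl v : F.level n ⊕ G.level n) = F.rootedHomCount t v := by
  induction t generalizing n with
  | point => rfl
  | graft s t ihs iht =>
    simp only [rootedHomCount, iht]
    congr 1
    let e : F.Child v ≃ (F.sum G).Child (Sum.inl v : F.level n ⊕ G.level n) :=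
      { toFun c := ⟨Sum.inl c.1, congrArg Sum.inl c.2⟩
        invFun
          | ⟨Sum.inl c, h⟩ => ⟨c, Sum.inl_injective h⟩
          | ⟨Sum.inr c, h⟩ => nomatch h
        left_inv _ := rfl
        right_inv := by
          rintro ⟨c | c, h⟩
          · rfl
          · nomatch h }
    rw [← e.tsum_eq]
    exact tsum_congr fun c => ihs c.1

theorem rootedHomCount_sum_inr (F G : LevelForest) (t : PlaneTree) {n : ℕ} (v : G.level n) :
    (F.sum G).rootedHomCount t (Sum.inr v : F.level n ⊕ G.level n) = G.rootedHomCount t v := by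
  induction t generalizing n with
  | point => rfl
  | graft s t ihs iht =>
    simp only [rootedHomCount, iht]
    congr 1
    let e : G.Child v ≃ (F.sum G).Child (Sum.inr v : F.level n ⊕ G.level n) :=
      { toFun c := ⟨Sum.inr c.1, congrArg Sum.inr c.2⟩
        invFun
          | ⟨Sum.inr c, h⟩ => ⟨c, Sum.inr_injective h⟩
          | ⟨Sum.inl c, h⟩ => nomatch h
        left_inv _ := rfl
        right_inv := by
          rintro ⟨c | c, h⟩
          · nomatch h
          · rfl }
    rw [← e.tsum_eq]
    exact tsum_congr fun c => ihs c.1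

theorem homCount_sum (F G : LevelForest) (t : PlaneTree) :
    (F.sum G).homCount t = F.homCount t + G.homCount t := by
  refine (Summable.tsum_sum (f := fun v : F.level 0 ⊕ G.level 0 => (F.sum G).rootedHomCount t v)
    ENNReal.summable ENNReal.summable).trans ?_
  simp only [rootedHomCount_sum_inl, rootedHomCount_sum_inr, homCount]

theorem rootedHomCount_prod (F G : LevelForest) (t : PlaneTree) {n : ℕ} (v : F.level n)
    (w : G.level n) : (F.prod G).rootedHomCount t ((v, w) : F.level n × G.level n) =
      F.rootedHomCount t v * G.rootedHomCount t w := by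
  induction t generalizing n with
  | point => exact (one_mul 1).symm
  | graft s t ihs iht =>
    simp only [rootedHomCount, iht]
    rw [mul_mul_mul_comm]
    congr 1
    let e : F.Child v × G.Child w ≃ (F.prod G).Child ((v, w) : F.level n × G.level n) :=
      { toFun c := ⟨(c.1.1, c.2.1), Prod.ext c.1.2 c.2.2⟩
        invFun c := (⟨c.1.1, congrArg Prod.fst c.2⟩, ⟨c.1.2, congrArg Prod.snd c.2⟩)
        left_inv _ := rfl
        right_inv _ := rfl }
    rw [← e.tsum_eq, ENNReal.tsum_prod', ← ENNReal.tsum_mul_right]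
    refine tsum_congr fun c => ?_
    rw [← ENNReal.tsum_mul_left]
    exact tsum_congr fun d => ihs c.1 d.1

theorem homCount_prod (F G : LevelForest) (t : PlaneTree) :
    (F.prod G).homCount t = F.homCount t * G.homCount t := by
  refine (ENNReal.tsum_prod' (f := fun v : F.level 0 × G.level 0 =>
    (F.prod G).rootedHomCount t v)).trans ?_
  simp only [rootedHomCount_prod, homCount, ENNReal.tsum_mul_left, ENNReal.tsum_mul_right]

theorem homCount_empty (t : PlaneTree) : empty.homCount t = 0 :=
  have : IsEmpty (empty.level 0) := inferInstanceAs (IsEmpty Empty)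
  tsum_empty

theorem rootedHomCount_path (t : PlaneTree) {n : ℕ} (v : path.level n) :
    path.rootedHomCount t v = 1 := by
  induction t generalizing n with
  | point => rfl
  | graft s t ihs iht =>
    simp only [rootedHomCount, iht, ihs, mul_one]
    have : Unique (path.Child v) := ⟨⟨⟨(), rfl⟩⟩, fun _ => rfl⟩
    rw [tsum_fintype, Fintype.sum_unique]

theorem homCount_path (t : PlaneTree) : path.homCount t = 1 := by
  simp only [homCount, rootedHomCount_path]
  have : Unique (path.level 0) := inferInstanceAs (Unique Unit)
  rw [tsum_fintype, Fintype.sum_unique]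

/-! ### Reconstruction of a locally finite forest from its counts -/

/-- A forest is locally finite when it has finitely many nodes of each depth. -/
class LocallyFinite (F : LevelForest) : Prop where
  finite_level : ∀ n, Finite (F.level n)

attribute [instance] LocallyFinite.finite_level

theorem rootedHomCount_ne_top (F : LevelForest) [F.LocallyFinite] (t : PlaneTree) {n : ℕ}
    (v : F.level n) : F.rootedHomCount t v ≠ ⊤ := by
  induction t generalizing n with
  | point => exact ENNReal.one_ne_top
  | graft s t ihs iht =>
    have := Fintype.ofFinite (F.Child v)
    simp only [rootedHomCount, tsum_fintype]
    exact ENNReal.mul_ne_top (ENNReal.sum_ne_top.2 fun c _ => ihs c.1) (iht v)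

theorem homCount_ne_top (F : LevelForest) [F.LocallyFinite] (t : PlaneTree) :
    F.homCount t ≠ ⊤ := by
  have := Fintype.ofFinite (F.level 0)
  simp only [homCount, tsum_fintype]
  exact ENNReal.sum_ne_top.2 fun r _ => F.rootedHomCount_ne_top t r

/-- The homomorphism counts of a node, as a real character of the monoid of trees. -/
noncomputable def homCharacter (F : LevelForest) {n : ℕ} (v : F.level n) : PlaneTree →* ℝ where
  toFun t := (F.rootedHomCount t v).toReal
  map_one' := ENNReal.toReal_one
  map_mul' t u := by rw [rootedHomCount_mul, ENNReal.toReal_mul]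

theorem rootedHomCount_graft_point (F : LevelForest) (s : PlaneTree) {n : ℕ} (v : F.level n) :
    F.rootedHomCount (.graft s .point) v = ∑' c : F.Child v, F.rootedHomCount s c.1 :=
  mul_one _

theorem exists_equiv_of_tsum_rootedHomCount_eq {F G : LevelForest} [F.LocallyFinite]
    [G.LocallyFinite] {n : ℕ} {α β : Type} [Finite α] [Finite β] (f : α → F.level n)
    (g : β → G.level n)
    (h : ∀ t, ∑' a, F.rootedHomCount t (f a) = ∑' b, G.rootedHomCount t (g b)) :
    ∃ e : α ≃ β, ∀ a, G.homCharacter (g (e a)) = F.homCharacter (f a) := by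
  have := Fintype.ofFinite α
  have := Fintype.ofFinite β
  refine exists_equiv_of_sum_monoidHom_eq (fun a => F.homCharacter (f a))
    (fun b => G.homCharacter (g b)) fun t => ?_
  have ht := congrArg ENNReal.toReal (h t)
  rwa [tsum_fintype, tsum_fintype, ENNReal.toReal_sum fun a _ => F.rootedHomCount_ne_top t (f a),
    ENNReal.toReal_sum fun b _ => G.rootedHomCount_ne_top t (g b)] at ht

/-- The character of a node determines the sum of the characters of its children: its value at `s`
is the count of `s` planted on a new root. -/
theorem exists_child_equiv {F G : LevelForest} [F.LocallyFinite] [G.LocallyFinite] {n : ℕ}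
    {v : F.level n} {w : G.level n} (h : G.homCharacter w = F.homCharacter v) :
    ∃ e : F.Child v ≃ G.Child w,
      ∀ c, G.homCharacter (e c).1 = F.homCharacter c.1 := by
  refine exists_equiv_of_tsum_rootedHomCount_eq (fun c : F.Child v => c.1)
    (fun c : G.Child w => c.1) fun t => ?_
  rw [← rootedHomCount_graft_point, ← rootedHomCount_graft_point,
    ← ENNReal.toReal_eq_toReal_iff' (F.rootedHomCount_ne_top _ v) (G.rootedHomCount_ne_top _ w)]
  exact (DFunLike.congr_fun h _).symm

/-- The bijections of levels that respect homomorphism counts. -/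
abbrev CharEquiv (F G : LevelForest) (n : ℕ) : Type :=
  {e : F.level n ≃ G.level n // ∀ v, G.homCharacter (e v) = F.homCharacter v}

/-- A bijection of levels that respects homomorphism counts extends to the next level. -/
theorem CharEquiv.exists_succ {F G : LevelForest} [F.LocallyFinite] [G.LocallyFinite] {n : ℕ}
    (e : CharEquiv F G n) :
    ∃ e' : CharEquiv F G (n + 1), ∀ v, e.1 (F.parent n v) = G.parent n (e'.1 v) := by
  choose c hc using fun v => exists_child_equiv (e.2 v)
  -- Level `n + 1` is the disjoint union of the sets of children of the nodes of level `n`, so the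
  -- child bijections glue along `e`.
  let e' : F.level (n + 1) ≃ G.level (n + 1) :=
    (Equiv.sigmaFiberEquiv (F.parent n)).symm.trans
      ((Equiv.sigmaCongr e.1 c).trans (Equiv.sigmaFiberEquiv (G.parent n)))
  exact ⟨⟨e', fun v => hc (F.parent n v) ⟨v, rfl⟩⟩,
    fun v => (c (F.parent n v) ⟨v, rfl⟩).2.symm⟩

/-- Locally finite forests are determined by the numbers of homomorphisms from finite trees. -/
theorem nonempty_iso_of_homCount_eq {F G : LevelForest} [F.LocallyFinite] [G.LocallyFinite]
    (h : ∀ t, F.homCount t = G.homCount t) : Nonempty (Iso F G) := by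
  obtain ⟨e₀, he₀⟩ := exists_equiv_of_tsum_rootedHomCount_eq (F := F) (G := G) (n := 0) id id h
  let e (n : ℕ) : CharEquiv F G n :=
    Nat.rec ⟨e₀, he₀⟩ (fun _ e => e.exists_succ.choose) n
  exact ⟨⟨fun n => (e n).1, fun n => (e n).exists_succ.choose_spec⟩⟩

/-! ### Vanishing of counts and depth -/

/-- A node has descendants `k` levels above it. -/
def HasDescendant (F : LevelForest) : ℕ → ∀ {n : ℕ}, F.level n → Prop
  | 0, _, _ => True
  | k + 1, _, v => ∃ c : F.Child v, HasDescendant F k c.1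

theorem HasDescendant.of_succ {F : LevelForest} {k n : ℕ} {v : F.level n}
    (h : F.HasDescendant (k + 1) v) : F.HasDescendant k v := by
  induction k generalizing n with
  | zero => trivial
  | succ k ih =>
    obtain ⟨c, hc⟩ := h
    exact ⟨c, ih hc⟩

theorem HasDescendant.mono {F : LevelForest} {k l n : ℕ} {v : F.level n} (hkl : k ≤ l)
    (h : F.HasDescendant l v) : F.HasDescendant k v := by
  induction hkl with
  | refl => exact h
  | step _ ih => exact ih h.of_succ

/-- A tree folds onto the path of its own height, so only the length of a chain of descendants
matters. -/
theorem rootedHomCount_ne_zero_iff (F : LevelForest) (t : PlaneTree) {n : ℕ} (v : F.level n) :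
    F.rootedHomCount t v ≠ 0 ↔ F.HasDescendant t.height v := by
  induction t generalizing n with
  | point => exact iff_of_true one_ne_zero trivial
  | graft s t ihs iht =>
    have hs : ∑' c : F.Child v, F.rootedHomCount s c.1 ≠ 0 ↔
        F.HasDescendant (s.height + 1) v := by
      rw [ne_eq, ENNReal.tsum_eq_zero, not_forall]
      exact exists_congr fun c => ihs c.1
    rw [rootedHomCount, mul_ne_zero_iff, hs, iht, PlaneTree.height]
    refine ⟨fun h => ?_, fun h => ⟨h.mono (le_max_left _ _), h.mono (le_max_right _ _)⟩⟩
    rcases max_choice (s.height + 1) t.height with h' | h' <;> rw [h']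
    exacts [h.1, h.2]

theorem HasDescendant.nonempty_level {F : LevelForest} {k n : ℕ} {v : F.level n}
    (h : F.HasDescendant k v) : Nonempty (F.level (n + k)) := by
  induction k generalizing n with
  | zero => exact ⟨v⟩
  | succ k ih =>
    obtain ⟨c, hc⟩ := h
    rw [Nat.add_succ, ← Nat.succ_add]
    exact ih hc

theorem exists_root_hasDescendant {F : LevelForest} {k n : ℕ} (v : F.level n)
    (h : F.HasDescendant k v) : ∃ r : F.level 0, F.HasDescendant (n + k) r := by
  induction n generalizing k with
  | zero => exact ⟨v, by rwa [Nat.zero_add]⟩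
  | succ n ih =>
    rw [Nat.succ_add, ← Nat.add_succ]
    exact ih (F.parent n v) ⟨⟨v, rfl⟩, h⟩

/-- A tree maps to a forest exactly when the forest is at least as deep. -/
theorem homCount_ne_zero_iff (F : LevelForest) (t : PlaneTree) :
    F.homCount t ≠ 0 ↔ Nonempty (F.level t.height) := by
  rw [homCount, ne_eq, ENNReal.tsum_eq_zero, not_forall]
  simp only [← ne_eq, rootedHomCount_ne_zero_iff]
  refine ⟨fun ⟨r, hr⟩ => ?_, fun ⟨v⟩ => exists_root_hasDescendant (k := 0) v trivial⟩
  simpa using hr.nonempty_level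

theorem nonempty_level_of_le {F : LevelForest} {k n : ℕ} (hkn : k ≤ n)
    (h : Nonempty (F.level n)) : Nonempty (F.level k) := by
  induction hkn with
  | refl => exact h
  | step _ ih => exact ih (h.map (F.parent _))

end LevelForest

/-! ### Counts on isomorphism classes -/

namespace Forest

open LevelForest

/-- The number of homomorphisms from a tree, as a homomorphism of semirings. -/
noncomputable def homCount (t : PlaneTree) : Forest →+* ℝ≥0∞ where
  toFun := Quotient.lift (fun F => F.homCount t) fun _ _ ⟨e⟩ => e.homCount_eq t
  map_zero' := homCount_empty t
  map_one' := homCount_path t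
  map_add' F G := by
    induction F using ind with | _ F
    induction G using ind with | _ G
    exact homCount_sum F G t
  map_mul' F G := by
    induction F using ind with | _ F
    induction G using ind with | _ G
    exact homCount_prod F G t

theorem homCount_mk (t : PlaneTree) (F : LevelForest) : homCount t (mk F) = F.homCount t := rfl

/-- A forest is locally finite when it has finitely many nodes of each depth. -/
def IsLocallyFinite (F : Forest) : Prop := ∃ G : LevelForest, G.LocallyFinite ∧ F = mk G

theorem IsLocallyFinite.homCount_ne_top {F : Forest} (hF : F.IsLocallyFinite) (t : PlaneTree) :
    homCount t F ≠ ⊤ := by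
  obtain ⟨F, _, rfl⟩ := hF
  exact F.homCount_ne_top t

theorem IsLocallyFinite.eq_of_homCount_eq {F G : Forest} (hF : F.IsLocallyFinite)
    (hG : G.IsLocallyFinite) (h : ∀ t, homCount t F = homCount t G) : F = G := by
  obtain ⟨F, _, rfl⟩ := hF
  obtain ⟨G, _, rfl⟩ := hG
  obtain ⟨e⟩ := nonempty_iso_of_homCount_eq h
  exact mk_eq e

theorem IsFinite.isLocallyFinite {F : Forest} (hF : F.IsFinite) : F.IsLocallyFinite := by
  induction F using ind with | _ F
  rw [isFinite_mk] at hF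
  exact ⟨F, ⟨fun n => Finite.of_injective (Sigma.mk n) sigma_mk_injective⟩, rfl⟩

theorem nonempty_level_zero {F : LevelForest} (hF : mk F ≠ 0) : Nonempty (F.level 0) := by
  by_contra h
  have hempty (n : ℕ) : IsEmpty (F.level n) :=
    not_nonempty_iff.1 fun hn => h (nonempty_level_of_le (Nat.zero_le n) hn)
  exact hF (mk_eq ⟨fun n => Equiv.equivOfIsEmpty (F.level n) Empty,
    fun n v => ((hempty (n + 1)).false v).elim⟩)

theorem homCount_ne_zero {F : Forest} (hF : F ≠ 0) {t : PlaneTree}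
    (ht : (t.height : ℕ∞) ≤ F.depth) : homCount t F ≠ 0 := by
  induction F using ind with | _ F
  rw [homCount_mk, homCount_ne_zero_iff]
  by_contra h
  -- Height zero is separate: the empty forest also has depth `0`, so here the bound on the depth
  -- gives nothing and `F ≠ 0` is used.
  have h0 : t.height ≠ 0 := fun h0 => h (h0 ▸ nonempty_level_zero hF)
  have hle : (mk F).depth ≤ ((t.height - 1 : ℕ) : ℕ∞) := by
    refine depth_mk_le.2 fun n hn => Nat.cast_le.2 ?_
    by_contra hlt
    exact h (nonempty_level_of_le (by lia) hn)
  have := Nat.cast_le.1 (ht.trans hle)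
  lia

theorem homCount_eq_zero {F : Forest} {t : PlaneTree} (ht : F.depth < t.height) :
    homCount t F = 0 := by
  induction F using ind with | _ F
  by_contra h
  exact ht.not_ge (depth_mk_le.1 le_rfl _ ((F.homCount_ne_zero_iff t).1 h))

/-- Polynomials with locally finite coefficients are injective on those locally finite forests that
are counted by trees on which some coefficient other than the constant one does not vanish. -/
theorem eq_of_sum_mul_pow_eq {m : ℕ} {A : ℕ → Forest} (hA : ∀ i ≤ m, (A i).IsLocallyFinite)
    {X Y : Forest} (hX : X.IsLocallyFinite) (hY : Y.IsLocallyFinite)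
    (h : ∑ i ∈ Finset.range (m + 1), A i * X ^ i = ∑ i ∈ Finset.range (m + 1), A i * Y ^ i)
    (ht : ∀ t, (∃ i, 1 ≤ i ∧ i ≤ m ∧ homCount t (A i) ≠ 0) ∨ homCount t X = homCount t Y) :
    X = Y := by
  refine hX.eq_of_homCount_eq hY fun t => ?_
  rcases ht t with ht | ht
  · refine ENNReal.eq_of_sum_mul_pow_eq (fun i hi => (hA i hi).homCount_ne_top t) ht
      (hX.homCount_ne_top t) (hY.homCount_ne_top t) ?_
    simpa only [map_sum, map_mul, map_pow] using congrArg (homCount t) h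
  · exact ht

end Forest

/-! ### Unrolls have nodes at every depth -/

namespace FDDS

instance (A : FDDS) : A.unroll.LocallyFinite := ⟨fun _ => inferInstanceAs (Finite (Subtype _))⟩

theorem exists_onCycle_iterate (A : FDDS) (a : A.State) : ∃ n, A.OnCycle (A.next^[n] a) := by
  obtain ⟨k, l, hkl, h⟩ := Finite.exists_ne_map_eq_of_infinite fun n => A.next^[n] a
  wlog hlt : k < l generalizing k l
  · exact this l k hkl.symm h.symm (by lia)
  refine ⟨k, l - k, by lia, ?_⟩
  change A.next^[l - k] (A.next^[k] a) = A.next^[k] a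
  rw [← Function.iterate_add_apply, Nat.sub_add_cancel hlt.le]
  exact h.symm

theorem nonempty_level_unroll {A : FDDS} (a : A.State) (k : ℕ) :
    Nonempty (A.unroll.level k) := by
  obtain ⟨n, m, hm, hn⟩ := A.exists_onCycle_iterate a
  -- A periodic state stays periodic under iteration, so it labels a node at each depth `k`.
  exact ⟨⟨A.next^[n] a, m, hm, hn.apply_iterate k⟩⟩

theorem homCount_unroll_ne_zero {A : FDDS} (hA : Forest.mk A.unroll ≠ 0) (t : PlaneTree) :
    A.unroll.homCount t ≠ 0 := by
  rw [LevelForest.homCount_ne_zero_iff]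
  obtain ⟨v⟩ := Forest.nonempty_level_zero hA
  exact nonempty_level_unroll v.1 _

end FDDS

theorem isLocallyFinite_of_mem_unrolls {F : Forest} (hF : F ∈ unrolls) : F.IsLocallyFinite := by
  obtain ⟨A, rfl⟩ := hF
  exact ⟨_, inferInstance, rfl⟩

theorem homCount_ne_zero_of_mem_unrolls {F : Forest} (hF : F ∈ unrolls) (h0 : F ≠ 0)
    (t : PlaneTree) : Forest.homCount t F ≠ 0 := by
  obtain ⟨A, rfl⟩ := hF
  exact FDDS.homCount_unroll_ne_zero h0 t

theorem mainTheorem7 :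
    (∀ P : Polynomial unrolls, (∃ i, 0 < i ∧ P.coeff i ≠ 0) →
      Function.Injective fun X : unrolls => P.eval X) ∧
    (∀ (m : ℕ) (A : ℕ → Forest) (dmax : ℕ∞),
      (∀ i ≤ m, (A i).IsFinite) →
      (∃ i, 1 ≤ i ∧ i ≤ m ∧ A i ≠ 0) →
      dmax = (Finset.Icc 1 m).sup (fun i => (A i).depth) →
      (A 0).depth ≤ dmax →
      Set.InjOn (fun X : Forest => ∑ i ∈ Finset.range (m + 1), A i * X ^ i)
        (Forest.finiteForests dmax)) := by
  constructor
  · rintro P ⟨i, hi, hPi⟩ X Y h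
    refine Subtype.ext (Forest.eq_of_sum_mul_pow_eq (m := P.natDegree)
      (A := fun i => (P.coeff i : Forest))
      (fun i _ => isLocallyFinite_of_mem_unrolls (P.coeff i).2)
      (isLocallyFinite_of_mem_unrolls X.2) (isLocallyFinite_of_mem_unrolls Y.2) ?_ fun t => .inl
      ⟨i, hi, Polynomial.le_natDegree_of_ne_zero hPi, homCount_ne_zero_of_mem_unrolls
        (P.coeff i).2 (fun h0 => hPi (Subtype.ext h0)) t⟩)
    have h' : P.eval X = P.eval Y := h
    rw [Polynomial.eval_eq_sum_range, Polynomial.eval_eq_sum_range] at h'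
    simpa only [map_sum, map_mul, map_pow, Subsemiring.subtype_apply] using
      congrArg unrolls.subtype h'
  · rintro m A dmax hA ⟨j, hj, hjm, hAj⟩ hd - X ⟨hX, hXd⟩ Y ⟨hY, hYd⟩ h
    refine Forest.eq_of_sum_mul_pow_eq (fun i hi => (hA i hi).isLocallyFinite)
      hX.isLocallyFinite hY.isLocallyFinite h fun t => ?_
    -- Short trees are detected by a coefficient of maximal depth; tall trees map neither to `X` nor
    -- to `Y`.
    rcases le_or_gt (t.height : ℕ∞) dmax with ht | ht
    · left
      obtain ⟨i, hi, hid⟩ := Finset.exists_mem_eq_sup (Finset.Icc 1 m)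
        ⟨j, Finset.mem_Icc.2 ⟨hj, hjm⟩⟩ (fun i => (A i).depth)
      rw [Finset.mem_Icc] at hi
      rw [hd, hid] at ht
      -- The maximum may be attained at a zero coefficient, of depth `0`; then `t` has height `0`
      -- and the nonzero `A j` detects it.
      by_cases h0 : A i = 0
      · refine ⟨j, hj, hjm, Forest.homCount_ne_zero hAj (ht.trans ?_)⟩
        simpa only [h0] using (Forest.finiteForests 0).zero_mem.2.trans zero_le
      · exact ⟨i, hi.1, hi.2, Forest.homCount_ne_zero h0 ht⟩
    · right
      rw [Forest.homCount_eq_zero (hXd.trans_lt ht), Forest.homCount_eq_zero (hYd.trans_lt ht)]
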